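/- **Theorem 3 (No False Positives).** For every sample size $n$ let $p=p_n$ be the number of covariates, let $\Omega_{X_1},\dots,\Omega_{X_p}$ and $(\Omega_Y,d_Y)$ be metric spaces with their Borel $\sigma$-fields, let $\kappa_j$ be a positive (semi)definite kernel on $\Omega_{X_j}$ with reproducing kernel Hilbert space $\mathcal M_j$ ($1\le j\le p$), the feature map $x\mapsto\kappa_j(\cdot,x)\in\mathcal M_j$ being strongly measurable, and let $(X_1,\dots,X_p,Y)$ be a random element of $\prod_j\Omega_{X_j}\times\Omega_Y$. Everything except $(\Omega_Y,d_Y)$ may depend on $n$. Fix $y,y_0\in\Omega_Y$ and put $U=d_Y^2(Y,y)-d_Y^2(Y,y_0)$. Assume the additive model $$U=\sum_{j=1}^p f_{0,j}(X_j)+\epsilon,\qquad f_{0,j}\in\mathcal M_j,\quad \mathbb E[\epsilon\mid X]=0,\quad \mathbb E[\epsilon^2]<\infty ,$$ and let $S_0=\{j: f_{0,j}\ne 0\}$ be the active set. On $\bigoplus_j\mathcal M_j$, with the Hilbert norm $\|\boldsymbol f\|^2=\sum_j\|f_j\|_{\mathcal M_j}^2$, let $$\Sigma=\mathbb E\big[(\kappa_1(\cdot,X_1),\dots,\kappa_p(\cdot,X_p))\otimes(\kappa_1(\cdot,X_1),\dots,\kappa_p(\cdot,X_p))\big]$$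 be the covariance operator and, for $S_1,S_2\subseteq\{1,\dots,p\}$, let $\Sigma_{S_1S_2}:\bigoplus_{k\in S_2}\mathcal M_k\to\bigoplus_{j\in S_1}\mathcal M_j$ be its sub-operators. For an operator $T:\bigoplus_{k\in S_2}\mathcal M_k\to\bigoplus_{j\in S_1}\mathcal M_j$ put $$\|T\|_{\infty,\infty}=\sup\Big\{\langle f_1,Tf_2\rangle:\ \max_{j\in S_1}\|f_{1,j}\|_{\mathcal M_j}\le1,\ \max_{k\in S_2}\|f_{2,k}\|_{\mathcal M_k}\le 1\Big\}.$$ Given $n$ i.i.d. copies $(X_{i1},\dots,X_{ip},Y_i)$ of $(X_1,\dots,X_p,Y)$ and tuning parameters $\lambda_1=\lambda_{1,n}>0$, $\lambda_2=\lambda_{2,n}>0$, let $U_i=d_Y^2(Y_i,y)-d_Y^2(Y_i,y_0)$, let $\hat{\boldsymbol f}=(\hat f_1,\dots,\hat f_p)$ be the minimizer over $\bigoplus_j\mathcal M_j$ of $$\frac1{2n}\sum_{i=1}^n\Big(U_i-\sum_{j=1}^p\langle f_j,\kappa_j(\cdot,X_{ij})\rangle_{\mathcal M_j}\Big)^2+\lambda_1\sum_{j=1}^p\|f_j\|_{\mathcal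 M_j}+\frac{\lambda_2}2\sum_{j=1}^p\|f_j\|_{\mathcal M_j}^2,$$ and let $\hat S=\{j:\hat f_j\neq0\}$. Suppose that there are constants $\gamma>0$, $C>1$, $K$ and $s\in\mathbb N$, not depending on $n$, such that: 1. (Irrepresentable) $\|\Sigma_{S_0^cS_0}(\Sigma_{S_0S_0}+\lambda_2I)^{-1}\|_{\infty,\infty}<1-\gamma$ for all $n$. 2. (Tuning) $\lambda_1/\lambda_2>C\,\frac{1-\gamma}{\gamma}$ for all $n$, and $\sqrt n\,\lambda_2^2/p\to\infty$, $\lambda_1\to0$ as $n\to\infty$. 3. (Boundedness) $\|\kappa_j(\cdot,x)\|_{\mathcal M_j}<K$ for all $n$, $j$ and $x\in\Omega_{X_j}$; $\sup_n\|\boldsymbol f_0\|<C$ with the same $C$ as in 2; and $\mathbb E[\epsilon^2]<K$, $\mathbb E[\kappa_j(X_j,X_j)]<K$ for all $n$, $j$. 4. (Dimension) $p=o(\sqrt n)$, and $|S_0|\le s$ for all $n$. Then $\mathbb P(\hat S\subseteq S_0)\to1$ as $n\to\infty$. -/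

import Mathlib

open MeasureTheory ProbabilityTheory Filter Topology Asymptotics
open scoped InnerProductSpace

noncomputable section

namespace AdditiveRKHS

section SingleModel

variable {ι : Type*} [Fintype ι] {𝒳 : ι → Type*} {M : ι → Type*}
  [∀ j, NormedAddCommGroup (M j)] [∀ j, InnerProductSpace ℝ (M j)] [∀ j, CompleteSpace (M j)]
  [∀ j, RKHS ℝ (M j) (𝒳 j) ℝ]

/-- The function `κ_j(·, x)`, as an element of the RKHS `M j` of the kernel `κ_j`. -/
def kfun (M : ι → Type*) [∀ j, NormedAddCommGroup (M j)] [∀ j, InnerProductSpace ℝ (M j)]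
    [∀ j, CompleteSpace (M j)] [∀ j, RKHS ℝ (M j) (𝒳 j) ℝ] (j : ι) (x : 𝒳 j) : M j :=
  RKHS.kerFun (M j) x 1

/-- The kernel `κ_j(x, x')`. -/
def ker (M : ι → Type*) [∀ j, NormedAddCommGroup (M j)] [∀ j, InnerProductSpace ℝ (M j)]
    [∀ j, CompleteSpace (M j)] [∀ j, RKHS ℝ (M j) (𝒳 j) ℝ] (j : ι) (x x' : 𝒳 j) : ℝ :=
  RKHS.kernel (M j) x x' 1

/-- The joint feature `(κ_1(·, x_1), …, κ_p(·, x_p))` in the Hilbert direct sum of the `M j`. -/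
def feature (M : ι → Type*) [∀ j, NormedAddCommGroup (M j)] [∀ j, InnerProductSpace ℝ (M j)]
    [∀ j, CompleteSpace (M j)] [∀ j, RKHS ℝ (M j) (𝒳 j) ℝ] (x : ∀ j, 𝒳 j) : PiLp 2 M :=
  WithLp.toLp 2 fun j => kfun M j (x j)

/-- The covariance operator `Σ = E[feature(X) ⊗ feature(X)]`, where `X` has law `ν`. -/
def covOp (M : ι → Type*) [∀ j, NormedAddCommGroup (M j)] [∀ j, InnerProductSpace ℝ (M j)]
    [∀ j, CompleteSpace (M j)] [∀ j, RKHS ℝ (M j) (𝒳 j) ℝ] [∀ j, MeasurableSpace (𝒳 j)]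
    (ν : Measure (∀ j, 𝒳 j)) : PiLp 2 M →L[ℝ] PiLp 2 M :=
  ∫ x, InnerProductSpace.rankOne ℝ (feature M x) (feature M x) ∂ν

/-- The coordinate restriction `(f_j)_j ↦ (f_j)_{j ∈ S}`. -/
def restrictL (M : ι → Type*) [∀ j, NormedAddCommGroup (M j)] [∀ j, InnerProductSpace ℝ (M j)]
    (S : Finset ι) : PiLp 2 M →L[ℝ] PiLp 2 (fun j : S => M j) :=
  (PiLp.continuousLinearEquiv 2 ℝ (fun j : S => M j)).symm.toContinuousLinearMap ∘L
    ContinuousLinearMap.pi fun j : S => PiLp.proj 2 M (j : ι)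

/-- The sub-operator `T_{S₁ S₂}`. The adjoint of the restriction to `S₂` is extension by zero,
see `adjoint_restrictL_apply`. -/
def block (S₁ S₂ : Finset ι) (T : PiLp 2 M →L[ℝ] PiLp 2 M) :
    PiLp 2 (fun j : S₂ => M j) →L[ℝ] PiLp 2 (fun j : S₁ => M j) :=
  restrictL M S₁ ∘L T ∘L ContinuousLinearMap.adjoint (restrictL M S₂)

open Classical in
/-- The set of indices of the nonzero components of `f`. -/
def activeSet (f : PiLp 2 M) : Finset ι := Finset.univ.filter fun j => f j ≠ 0

/-- The elastic-net objective for covariates `x i = (x i 1, …, x i p)` and responses `u i`,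
with penalties `l₁`, `l₂`. -/
def enetObj {n : ℕ} (l₁ l₂ : ℝ) (x : Fin n → ∀ j, 𝒳 j) (u : Fin n → ℝ) (f : PiLp 2 M) : ℝ :=
  1 / (2 * (n : ℝ)) * ∑ i, (u i - ∑ j, ⟪f j, kfun M j (x i j)⟫_ℝ) ^ 2
    + l₁ * ∑ j, ‖f j‖ + l₂ / 2 * ∑ j, ‖f j‖ ^ 2

/-- The transformed response `d²(y', y) - d²(y', y₀)` of an observation `y'`. -/
def response {𝒴 : Type*} [MetricSpace 𝒴] (y y₀ y' : 𝒴) : ℝ := dist y' y ^ 2 - dist y' y₀ ^ 2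

/-- The error `d²(Y, y) - d²(Y, y₀) - ∑ j, f_j(X_j)` of the additive model at `z = (X, Y)`. -/
def noise {𝒴 : Type*} [MetricSpace 𝒴] (y y₀ : 𝒴) (f : PiLp 2 M) (z : (∀ j, 𝒳 j) × 𝒴) : ℝ :=
  response y y₀ z.2 - ∑ j, (f j : M j) (z.1 j)

theorem adjoint_restrictL_apply [DecidableEq ι] (S : Finset ι) (g : PiLp 2 (fun j : S => M j))
    (j : ι) :
    (ContinuousLinearMap.adjoint (restrictL M S) g) j = if h : j ∈ S then g ⟨j, h⟩ else 0 := by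
  have key : ContinuousLinearMap.adjoint (restrictL M S) g =
      (WithLp.toLp 2 fun j => if h : j ∈ S then g ⟨j, h⟩ else 0 : PiLp 2 M) := by
    refine ext_inner_right ℝ fun f => ?_
    rw [ContinuousLinearMap.adjoint_inner_left, PiLp.inner_apply, PiLp.inner_apply]
    have h1 : ∀ j : S, ⟪g j, restrictL M S f j⟫_ℝ
        = (fun i : ι => ⟪(if h : i ∈ S then g ⟨i, h⟩ else 0 : M i), f i⟫_ℝ) j := by
      intro j
      simp [restrictL]
    rw [Finset.sum_congr rfl fun j _ => h1 j,
      Finset.sum_coe_sort S (fun i : ι => ⟪(if h : i ∈ S then g ⟨i, h⟩ else 0 : M i), f i⟫_ℝ)]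
    refine Finset.sum_subset (Finset.subset_univ S) fun i _ hi => ?_
    simp [hi]
  rw [key]

end SingleModel

/-- The `(∞,∞)`-norm `sup ⟨f₁, T f₂⟩` over all `f₁`, `f₂` whose components have norm at most one. -/
def infInfNorm {α β : Type*} [Fintype α] [Fintype β] {E : α → Type*} {F : β → Type*}
    [∀ a, NormedAddCommGroup (E a)] [∀ a, InnerProductSpace ℝ (E a)]
    [∀ b, NormedAddCommGroup (F b)] [∀ b, InnerProductSpace ℝ (F b)]
    (T : PiLp 2 F →L[ℝ] PiLp 2 E) : ℝ :=
  sSup {r : ℝ | ∃ (f₁ : PiLp 2 E) (f₂ : PiLp 2 F),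
    (∀ a, ‖f₁ a‖ ≤ 1) ∧ (∀ b, ‖f₂ b‖ ≤ 1) ∧ r = ⟪f₁, T f₂⟫_ℝ}

end AdditiveRKHS

end

noncomputable section

namespace AdditiveRKHS

/-! ### Ridge-regularised positive operators. -/

section Operators

variable {E : Type*} [NormedAddCommGroup E] [InnerProductSpace ℝ E] [CompleteSpace E]

/-! Write `S` for the active set of `f₀`, `T` and `T'` for the population and empirical covariance,
`W` for the sample mean of error times feature, `f` for the estimator and `r = T' (f₀ - f) + W - l₂
• f` for its score. Stationarity says `‖r j‖ ≤ l₁` and `⟪r j, f j⟫ ≥ l₁ ‖f j‖` for every `j`. If `v`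
is the part of `f` outside `S`, then `⟪r, v⟫ ≥ l₁ ∑ ‖v j‖`.

Eliminating the coordinates in `S` gives an opposite bound. What remains of the quadratic part is a
ridge Schur complement of `T'`, which is positive and enters with a favourable sign. Hence `⟪r, v⟫ ≤
⟪T' x + W, v⟫`, where `x` lives on `S` and solves `(T'_SS + l₂) x = (l₂ f₀ + r - W)_S`. Were `T' =
T` and `W = 0`, the irrepresentable condition would bound each component of `T x` outside `S` by `(1
- γ) (l₂ C₀ + l₁)`. The tuning ratio and `C₀ < C` put this below `l₁` by a fixed proportion
(`exists_margin`), which leaves room for perturbations `‖T' - T‖ ≤ ε l₂` and `‖W‖ ≤ ε l₁`. Then `v =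
0`. This is `activeSet_subset_of_stationary`; it treats the estimator itself and needs no auxiliary
estimator restricted to `S`.

Both perturbation bounds come from Chebyshev's inequality in a Hilbert space, with `T' - T` measured
in Hilbert–Schmidt norm. The failure probabilities are of order `p² / (n l₂²)` and `p / (n l₁²)`,
and both vanish under the tuning assumptions (`tendsto_falsePositiveBound`). -/

/-- A positive bounded operator plus a positive multiple of the identity is invertible. -/
theorem isInvertible_add_smul_id (B : E →L[ℝ] E) (hB : ∀ x, 0 ≤ ⟪B x, x⟫_ℝ) {c : ℝ} (hc : 0 < c) :
    (B + c • ContinuousLinearMap.id ℝ E).IsInvertible := by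
  set T := B + c • ContinuousLinearMap.id ℝ E
  have hco : IsCoercive ((innerSL ℝ : E →L[ℝ] E →L[ℝ] ℝ) ∘L T) := by
    refine ⟨c, hc, fun x => ?_⟩
    have : ((innerSL ℝ : E →L[ℝ] E →L[ℝ] ℝ) ∘L T) x x = ⟪B x, x⟫_ℝ + c * (‖x‖ * ‖x‖) := by
      change ⟪T x, x⟫_ℝ = _
      simp [T, inner_add_left, inner_smul_left, pow_two]
    rw [this]
    linarith [hB x]
  refine ⟨hco.continuousLinearEquivOfBilin, ?_⟩
  ext x
  refine ext_inner_right ℝ fun w => ?_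
  change ⟪hco.continuousLinearEquivOfBilin x, w⟫_ℝ = _
  rw [hco.continuousLinearEquivOfBilin_apply]
  rfl

-- Pairing with `x` discards the positive term, so the bound depends on `c` alone and not on `B`. It
-- will be applied to the random operator `T'`.
omit [CompleteSpace E] in
theorem mul_norm_le_of_add_smul_eq (B : E →L[ℝ] E) (hB : ∀ x, 0 ≤ ⟪B x, x⟫_ℝ) {c : ℝ}
    {x u : E} (h : B x + c • x = u) : c * ‖x‖ ≤ ‖u‖ := by
  rcases eq_or_ne x 0 with rfl | hx
  · simp
  have hx' : 0 < ‖x‖ := norm_pos_iff.2 hx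
  have h1 : ⟪u, x⟫_ℝ = ⟪B x, x⟫_ℝ + c * (‖x‖ * ‖x‖) := by
    rw [← h, inner_add_left, real_inner_smul_left, real_inner_self_eq_norm_mul_norm]
  have h2 := real_inner_le_norm u x
  have h3 := hB x
  refine le_of_mul_le_mul_right ?_ hx'
  linarith

end Operators

/-! ### The max-norm operator bound. -/

section InfInfNorm

variable {α β : Type*} [Fintype α] [Fintype β] {E : α → Type*} {F : β → Type*}
    [∀ a, NormedAddCommGroup (E a)] [∀ a, InnerProductSpace ℝ (E a)]
    [∀ b, NormedAddCommGroup (F b)] [∀ b, InnerProductSpace ℝ (F b)]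

omit [∀ a, InnerProductSpace ℝ (E a)] in
theorem norm_sq_le_card_mul {r : ℝ} (f : PiLp 2 E) (hf : ∀ a, ‖f a‖ ≤ r) :
    ‖f‖ ^ 2 ≤ Fintype.card α * r ^ 2 := by
  rw [PiLp.norm_sq_eq_of_L2]
  calc ∑ a, ‖f a‖ ^ 2 ≤ ∑ _a : α, r ^ 2 :=
        Finset.sum_le_sum fun a _ => pow_le_pow_left₀ (norm_nonneg _) (hf a) 2
    _ = _ := by simp

/-- The real `sSup` of an unbounded set is `0`, so this is what makes `infInfNorm` a genuine
supremum. The size of the bound plays no role. -/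
theorem bddAbove_infInfNorm (T : PiLp 2 F →L[ℝ] PiLp 2 E) :
    BddAbove {r : ℝ | ∃ (f₁ : PiLp 2 E) (f₂ : PiLp 2 F),
      (∀ a, ‖f₁ a‖ ≤ 1) ∧ (∀ b, ‖f₂ b‖ ≤ 1) ∧ r = ⟪f₁, T f₂⟫_ℝ} := by
  refine ⟨√(Fintype.card α) * (‖T‖ * √(Fintype.card β)), ?_⟩
  rintro r ⟨f₁, f₂, h₁, h₂, rfl⟩
  have e₁ : ‖f₁‖ ≤ √(Fintype.card α) :=
    Real.le_sqrt_of_sq_le (by simpa using norm_sq_le_card_mul f₁ h₁)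
  have e₂ : ‖f₂‖ ≤ √(Fintype.card β) :=
    Real.le_sqrt_of_sq_le (by simpa using norm_sq_le_card_mul f₂ h₂)
  calc ⟪f₁, T f₂⟫_ℝ ≤ ‖f₁‖ * ‖T f₂‖ := real_inner_le_norm _ _
    _ ≤ ‖f₁‖ * (‖T‖ * ‖f₂‖) := by gcongr; exact T.le_opNorm _
    _ ≤ _ := by gcongr

theorem inner_le_infInfNorm (T : PiLp 2 F →L[ℝ] PiLp 2 E) {f₁ : PiLp 2 E} {f₂ : PiLp 2 F}
    (h₁ : ∀ a, ‖f₁ a‖ ≤ 1) (h₂ : ∀ b, ‖f₂ b‖ ≤ 1) : ⟪f₁, T f₂⟫_ℝ ≤ infInfNorm T :=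
  le_csSup (bddAbove_infInfNorm T) ⟨f₁, f₂, h₁, h₂, rfl⟩

theorem infInfNorm_nonneg (T : PiLp 2 F →L[ℝ] PiLp 2 E) : 0 ≤ infInfNorm T := by
  simpa using inner_le_infInfNorm T (f₁ := 0) (f₂ := 0) (by simp) (by simp)

/-- The `(∞,∞)`-norm dominates the operator norm from the max norm to the max norm. -/
theorem norm_apply_le_infInfNorm_mul (T : PiLp 2 F →L[ℝ] PiLp 2 E) {r : ℝ} (hr : 0 < r)
    {f : PiLp 2 F} (hf : ∀ b, ‖f b‖ ≤ r) (a : α) : ‖T f a‖ ≤ infInfNorm T * r := by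
  classical
  rcases eq_or_ne (T f a) 0 with h0 | h0
  · rw [h0, norm_zero]
    exact mul_nonneg (infInfNorm_nonneg T) hr.le
  have hpos : 0 < ‖T f a‖ := norm_pos_iff.2 h0
  -- The test vector is the unit vector in the direction of `T f a`, placed in slot `a`.
  have key := inner_le_infInfNorm T
    (f₁ := WithLp.toLp 2 (Pi.single a (‖T f a‖⁻¹ • T f a))) (f₂ := r⁻¹ • f) ?_ ?_
  · have : ⟪(WithLp.toLp 2 (Pi.single a (‖T f a‖⁻¹ • T f a)) : PiLp 2 E), T (r⁻¹ • f)⟫_ℝ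
        = ‖T f a‖ * r⁻¹ := by
      rw [PiLp.inner_apply, Finset.sum_eq_single a]
      · simp [inner_smul_left, inner_smul_right]
        field_simp
      · intro b _ hb
        simp [Pi.single_eq_of_ne hb]
      · simp
    rw [this] at key
    rwa [← div_eq_mul_inv, div_le_iff₀ hr] at key
  · intro b
    rcases eq_or_ne b a with rfl | hb
    · simp [norm_smul, hpos.ne']
    · simp [Pi.single_eq_of_ne hb]
  · intro b
    rw [PiLp.smul_apply, norm_smul, norm_inv, Real.norm_of_nonneg hr.le, inv_mul_le_iff₀ hr]
    simpa using hf b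

end InfInfNorm

/-! ### Restriction to a coordinate set and extension by zero. -/

section Restriction

variable {ι : Type*} [Fintype ι] {M : ι → Type*}
  [∀ j, NormedAddCommGroup (M j)] [∀ j, InnerProductSpace ℝ (M j)]

omit [Fintype ι] in
@[simp]
theorem restrictL_apply (S : Finset ι) (f : PiLp 2 M) (j : S) : restrictL M S f j = f j := rfl

variable [∀ j, CompleteSpace (M j)]

theorem restrictL_adjoint_apply (S : Finset ι) (g : PiLp 2 (fun j : S => M j)) :
    restrictL M S (ContinuousLinearMap.adjoint (restrictL M S) g) = g := by
  classical
  ext j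
  rw [restrictL_apply, adjoint_restrictL_apply]
  simp

theorem adjoint_restrictL_apply_of_mem (S : Finset ι) (f : PiLp 2 M) {j : ι} (hj : j ∈ S) :
    ContinuousLinearMap.adjoint (restrictL M S) (restrictL M S f) j = f j := by
  classical
  rw [adjoint_restrictL_apply]
  simp [hj]

theorem adjoint_restrictL_apply_of_notMem (S : Finset ι) (g : PiLp 2 (fun j : S => M j)) {j : ι}
    (hj : j ∉ S) : ContinuousLinearMap.adjoint (restrictL M S) g j = 0 := by
  classical
  rw [adjoint_restrictL_apply]
  simp [hj]

theorem norm_adjoint_restrictL (S : Finset ι) (g : PiLp 2 (fun j : S => M j)) :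
    ‖ContinuousLinearMap.adjoint (restrictL M S) g‖ = ‖g‖ := by
  have h : ‖ContinuousLinearMap.adjoint (restrictL M S) g‖ ^ 2 = ‖g‖ ^ 2 := by
    rw [← real_inner_self_eq_norm_sq, ← real_inner_self_eq_norm_sq,
      ContinuousLinearMap.adjoint_inner_left, restrictL_adjoint_apply]
  exact (pow_left_inj₀ (norm_nonneg _) (norm_nonneg _) two_ne_zero).1 h

theorem norm_restrictL_le (S : Finset ι) (f : PiLp 2 M) : ‖restrictL M S f‖ ≤ ‖f‖ := by
  have h : ‖restrictL M S f‖ * ‖restrictL M S f‖ ≤ ‖restrictL M S f‖ * ‖f‖ := by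
    calc _ = ⟪ContinuousLinearMap.adjoint (restrictL M S) (restrictL M S f), f⟫_ℝ := by
          rw [ContinuousLinearMap.adjoint_inner_left, real_inner_self_eq_norm_mul_norm]
      _ ≤ _ := by
          refine (real_inner_le_norm _ _).trans_eq ?_
          rw [norm_adjoint_restrictL]
  rcases (norm_nonneg (restrictL M S f)).eq_or_lt with h0 | h0
  · rw [← h0]; exact norm_nonneg _
  · exact le_of_mul_le_mul_left h h0

theorem inner_block_self_nonneg (S : Finset ι) {T : PiLp 2 M →L[ℝ] PiLp 2 M}
    (hT : ∀ f, 0 ≤ ⟪T f, f⟫_ℝ) (g : PiLp 2 (fun j : S => M j)) : 0 ≤ ⟪block S S T g, g⟫_ℝ := by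
  have := hT (ContinuousLinearMap.adjoint (restrictL M S) g)
  rwa [ContinuousLinearMap.adjoint_inner_right] at this

omit [∀ j, InnerProductSpace ℝ (M j)] [∀ j, CompleteSpace (M j)] in
theorem mem_activeSet {f : PiLp 2 M} {j : ι} : j ∈ activeSet f ↔ f j ≠ 0 := by
  simp [activeSet]

end Restriction

/-- Divide by `t` and let `t` decrease to zero: the first-order term decides. -/
theorem nonneg_of_forall_mul_add_sq_mul_nonneg {a c : ℝ}
    (h : ∀ t : ℝ, 0 < t → t ≤ 1 → 0 ≤ t * a + t ^ 2 * c) : 0 ≤ a := by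
  have h1 : ∀ᶠ t : ℝ in 𝓝[>] 0, 0 ≤ a + t * c := by
    filter_upwards [Ioc_mem_nhdsGT (zero_lt_one' ℝ)] with t ht
    have := h t ht.1 ht.2
    have h2 : 0 ≤ t * (a + t * c) := by linarith
    exact nonneg_of_mul_nonneg_right h2 ht.1
  have h2 : Tendsto (fun t : ℝ => a + t * c) (𝓝[>] 0) (𝓝 a) := by
    have : Tendsto (fun t : ℝ => a + t * c) (𝓝 0) (𝓝 (a + 0 * c)) :=
      (by fun_prop : Continuous fun t : ℝ => a + t * c).tendsto 0
    rw [zero_mul, add_zero] at this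
    exact this.mono_left nhdsWithin_le_nhds
  exact ge_of_tendsto h2 h1

/-! ### Stationarity and deterministic support recovery. -/

section Estimator

variable {ι : Type*} [Fintype ι] {𝒳 : ι → Type*} {M : ι → Type*}
  [∀ j, NormedAddCommGroup (M j)] [∀ j, InnerProductSpace ℝ (M j)] [∀ j, CompleteSpace (M j)]
  [∀ j, RKHS ℝ (M j) (𝒳 j) ℝ]

theorem sum_inner_kfun (f : PiLp 2 M) (x : ∀ j, 𝒳 j) :
    ∑ j, ⟪f j, kfun M j (x j)⟫_ℝ = ⟪f, feature M x⟫_ℝ := by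
  rw [PiLp.inner_apply]; rfl

theorem sum_apply_eq_inner_feature (f : PiLp 2 M) (x : ∀ j, 𝒳 j) :
    ∑ j, (f j : M j) (x j) = ⟪f, feature M x⟫_ℝ := by
  rw [← sum_inner_kfun]
  simp [kfun]

theorem norm_feature_sq_le {K : ℝ} (hK : ∀ j x, ‖kfun M j x‖ ≤ K) (x : ∀ j, 𝒳 j) :
    ‖feature M x‖ ^ 2 ≤ Fintype.card ι * K ^ 2 :=
  norm_sq_le_card_mul (feature M x) fun j => hK j (x j)

/-- The negative gradient at `f` of the smooth part of the elastic-net objective. -/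
def enetScore {n : ℕ} (l₂ : ℝ) (x : Fin n → ∀ j, 𝒳 j) (u : Fin n → ℝ) (f : PiLp 2 M) : PiLp 2 M :=
  (1 / (n : ℝ)) • ∑ i, (u i - ⟪f, feature M (x i)⟫_ℝ) • feature M (x i) - l₂ • f

/-- First-order optimality as a variational inequality, which avoids subdifferentials. Along `f + t
• w` the quadratic part is expanded exactly and the penalty is bounded by convexity. -/
theorem inner_enetScore_le {n : ℕ} {l₁ l₂ : ℝ} (hl₁ : 0 ≤ l₁) {x : Fin n → ∀ j, 𝒳 j}
    {u : Fin n → ℝ} {f : PiLp 2 M} (hf : IsMinOn (enetObj l₁ l₂ x u) Set.univ f) (w : PiLp 2 M) :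
    ⟪enetScore l₂ x u f, w⟫_ℝ ≤ l₁ * ∑ j, (‖f j + w j‖ - ‖f j‖) := by
  suffices 0 ≤ l₁ * ∑ j, (‖f j + w j‖ - ‖f j‖) - ⟪enetScore l₂ x u f, w⟫_ℝ by linarith
  set a : Fin n → ℝ := fun i => u i - ⟪f, feature M (x i)⟫_ℝ with ha
  set b : Fin n → ℝ := fun i => ⟪w, feature M (x i)⟫_ℝ with hb
  refine nonneg_of_forall_mul_add_sq_mul_nonneg
    (c := 1 / (2 * (n : ℝ)) * ∑ i, b i ^ 2 + l₂ / 2 * ‖w‖ ^ 2) fun t ht ht1 => ?_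
  have hmin : enetObj l₁ l₂ x u f ≤ enetObj l₁ l₂ x u (f + t • w) := hf (Set.mem_univ _)
  have hobj : ∀ g : PiLp 2 M, enetObj l₁ l₂ x u g =
      1 / (2 * (n : ℝ)) * ∑ i, (u i - ⟪g, feature M (x i)⟫_ℝ) ^ 2
        + l₁ * ∑ j, ‖g j‖ + l₂ / 2 * ‖g‖ ^ 2 := by
    intro g
    simp only [enetObj, sum_inner_kfun, PiLp.norm_sq_eq_of_L2]
  rw [hobj, hobj] at hmin
  have hres : ∀ i, u i - ⟪f + t • w, feature M (x i)⟫_ℝ = a i - t * b i := by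
    intro i
    simp only [ha, hb, inner_add_left, real_inner_smul_left]
    ring
  have hsq : ∑ i, (a i - t * b i) ^ 2
      = ∑ i, a i ^ 2 - 2 * t * ∑ i, a i * b i + t ^ 2 * ∑ i, b i ^ 2 := by
    rw [Finset.mul_sum, Finset.mul_sum, ← Finset.sum_sub_distrib, ← Finset.sum_add_distrib]
    exact Finset.sum_congr rfl fun i _ => by ring
  have hnorm : ‖f + t • w‖ ^ 2 = ‖f‖ ^ 2 + 2 * t * ⟪f, w⟫_ℝ + t ^ 2 * ‖w‖ ^ 2 := by
    rw [norm_add_sq_real, real_inner_smul_right, norm_smul, mul_pow, Real.norm_eq_abs, sq_abs]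
    ring
  have hpen : ∑ j, ‖(f + t • w) j‖ ≤ ∑ j, ‖f j‖ + t * ∑ j, (‖f j + w j‖ - ‖f j‖) := by
    rw [Finset.mul_sum, ← Finset.sum_add_distrib]
    refine Finset.sum_le_sum fun j _ => ?_
    have : (f + t • w) j = (1 - t) • f j + t • (f j + w j) := by
      simp only [PiLp.add_apply, PiLp.smul_apply, smul_add, sub_smul, one_smul]
      abel
    rw [this]
    refine (norm_add_le _ _).trans_eq ?_
    rw [norm_smul, norm_smul, Real.norm_of_nonneg ht.le, Real.norm_of_nonneg (by linarith)]
    ring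
  have hscore : ⟪enetScore l₂ x u f, w⟫_ℝ = 1 / (n : ℝ) * ∑ i, a i * b i - l₂ * ⟪f, w⟫_ℝ := by
    simp only [enetScore, inner_sub_left, real_inner_smul_left, sum_inner, hb]
    simp only [ha, real_inner_comm w]
  simp only [hres] at hmin
  rw [hsq, hnorm] at hmin
  rw [hscore]
  have hpen' := mul_le_mul_of_nonneg_left hpen hl₁
  have h2n : 1 / (n : ℝ) = 2 * (1 / (2 * (n : ℝ))) := by
    rw [one_div, one_div, mul_inv]; ring
  rw [h2n]
  set q := 1 / (2 * (n : ℝ))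
  linarith

theorem norm_enetScore_apply_le {n : ℕ} {l₁ l₂ : ℝ} (hl₁ : 0 ≤ l₁) {x : Fin n → ∀ j, 𝒳 j}
    {u : Fin n → ℝ} {f : PiLp 2 M} (hf : IsMinOn (enetObj l₁ l₂ x u) Set.univ f) (j : ι) :
    ‖enetScore l₂ x u f j‖ ≤ l₁ := by
  classical
  have h := inner_enetScore_le hl₁ hf (WithLp.toLp 2 (Pi.single j (enetScore l₂ x u f j)))
  set r := enetScore l₂ x u f
  rw [PiLp.inner_apply, Finset.sum_eq_single j, Finset.sum_eq_single j] at h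
  · simp only [Pi.single_eq_same, real_inner_self_eq_norm_mul_norm] at h
    have h1 := norm_add_le (f j) (r j)
    have h2 : ‖r j‖ * ‖r j‖ ≤ l₁ * ‖r j‖ :=
      h.trans (mul_le_mul_of_nonneg_left (by linarith) hl₁)
    rcases (norm_nonneg (r j)).eq_or_lt with h0 | h0
    · rw [← h0]; exact hl₁
    · exact le_of_mul_le_mul_right h2 h0
  all_goals simp +contextual [Pi.single_eq_of_ne]

theorem mul_norm_le_inner_enetScore {n : ℕ} {l₁ l₂ : ℝ} (hl₁ : 0 ≤ l₁) {x : Fin n → ∀ j, 𝒳 j}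
    {u : Fin n → ℝ} {f : PiLp 2 M} (hf : IsMinOn (enetObj l₁ l₂ x u) Set.univ f) (j : ι) :
    l₁ * ‖f j‖ ≤ ⟪enetScore l₂ x u f j, f j⟫_ℝ := by
  classical
  -- The perturbation deletes the `j`-th component of `f`.
  have h := inner_enetScore_le hl₁ hf (WithLp.toLp 2 (Pi.single j (-f j)))
  rw [PiLp.inner_apply, Finset.sum_eq_single j, Finset.sum_eq_single j] at h
  · simp only [Pi.single_eq_same, inner_neg_right, add_neg_cancel, norm_zero] at h
    linarith
  all_goals simp +contextual [Pi.single_eq_of_ne]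

/-- Deterministic support recovery: if the score `r` of `f` satisfies the stationarity conditions
of the elastic net, and the empirical covariance `T'` and the noise term `W` are close to the
population covariance `T` and to zero, then the irrepresentable condition rules out false
positives. -/
theorem activeSet_subset_of_stationary [DecidableEq ι] {f₀ f r W : PiLp 2 M} {T T' : PiLp 2 M →L[ℝ] PiLp 2 M}
    {l₁ l₂ γ C₀ ε : ℝ} {s : ℕ} (hl₁ : 0 < l₁) (hl₂ : 0 < l₂) (hγ : 0 < γ) (hε : 0 ≤ ε)
    (hT : ∀ g, 0 ≤ ⟪T g, g⟫_ℝ) (hT' : ∀ g, 0 ≤ ⟪T' g, g⟫_ℝ)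
    (hsymm : ∀ g h, ⟪T' g, h⟫_ℝ = ⟪T' h, g⟫_ℝ)
    (hr : r = T' (f₀ - f) + W - l₂ • f) (hr₁ : ∀ j, ‖r j‖ ≤ l₁)
    (hr₂ : ∀ j, l₁ * ‖f j‖ ≤ ⟪r j, f j⟫_ℝ)
    (hirr : infInfNorm (block (activeSet f₀)ᶜ (activeSet f₀) T ∘L
        (block (activeSet f₀) (activeSet f₀) T + l₂ • ContinuousLinearMap.id ℝ _).inverse) < 1 - γ)
    (hC₀ : ‖f₀‖ ≤ C₀) (hs : (activeSet f₀).card ≤ s)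
    (hTT' : ‖T' - T‖ ≤ ε * l₂) (hW : ‖W‖ ≤ ε * l₁)
    (hmargin : (1 - γ) * (l₂ * C₀ + l₁) + 2 * (ε * l₁)
      + 2 * (ε * (l₂ * C₀ + (s + 1) * l₁ + ε * l₁)) < l₁) :
    activeSet f ⊆ activeSet f₀ := by
  set S := activeSet f₀ with hS
  set R := restrictL M S with hR
  set A := ContinuousLinearMap.adjoint R with hA
  set B := block S S T + l₂ • ContinuousLinearMap.id ℝ _ with hB
  set Q := block Sᶜ S T ∘L B.inverse with hQ
  have hγ1 : γ < 1 := by linarith [infInfNorm_nonneg Q]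
  have hC₀' : 0 ≤ C₀ := (norm_nonneg _).trans hC₀
  have hBinv : B.IsInvertible :=
    isInvertible_add_smul_id _ (inner_block_self_nonneg S hT) hl₂
  have hRA : ∀ g, R (A g) = g := restrictL_adjoint_apply S
  have hAR : ∀ g h, ⟪A g, h⟫_ℝ = ⟪g, R h⟫_ℝ := fun g h =>
    ContinuousLinearMap.adjoint_inner_left _ _ _
  have hf₀ : A (R f₀) = f₀ := by
    ext j
    by_cases hj : j ∈ S
    · exact adjoint_restrictL_apply_of_mem S f₀ hj
    · rw [adjoint_restrictL_apply_of_notMem S _ hj]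
      have : ¬ f₀ j ≠ 0 := fun h => hj (mem_activeSet.2 h)
      simpa using (not_not.1 this).symm
  set u := R (l₂ • f₀ + r - W) with hu
  -- `x` is the value that `f₀ - f` would have on `S` if `f` vanished outside `S`.
  obtain ⟨x, hx⟩ := (isInvertible_add_smul_id (block S S T') (inner_block_self_nonneg S hT')
    hl₂).surjective u
  replace hx : R (T' (A x)) + l₂ • x = u := hx
  -- The factor `s + 1` is a crude substitute for `√s`.
  have hRr : ‖R r‖ ≤ (s + 1) * l₁ := by
    have h1 : ‖R r‖ ^ 2 ≤ s * l₁ ^ 2 := by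
      refine (norm_sq_le_card_mul (R r) fun j => hr₁ j).trans ?_
      rw [Fintype.card_coe]
      gcongr
    refine abs_le_of_sq_le_sq' ?_ (by positivity) |>.2
    nlinarith [sq_nonneg l₁, sq_nonneg (s * l₁), (Nat.cast_nonneg s : (0 : ℝ) ≤ s)]
  have hunorm : ‖u‖ ≤ l₂ * C₀ + (s + 1) * l₁ + ε * l₁ := by
    have h1 : u = R (l₂ • f₀) + R r - R W := by rw [hu, map_sub, map_add]
    have h2 : ‖R (l₂ • f₀)‖ ≤ l₂ * C₀ := by
      refine (norm_restrictL_le S _).trans ?_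
      rw [norm_smul, Real.norm_of_nonneg hl₂.le]
      gcongr
    have h3 : ‖R W‖ ≤ ε * l₁ := (norm_restrictL_le S _).trans hW
    rw [h1]
    linarith [norm_sub_le (R (l₂ • f₀) + R r) (R W), norm_add_le (R (l₂ • f₀)) (R r)]
  have hxnorm : l₂ * ‖x‖ ≤ ‖u‖ :=
    mul_norm_le_of_add_smul_eq (block S S T') (inner_block_self_nonneg S hT') hx
  set d := (T' - T) (A x) with hd
  have hdnorm : ‖d‖ ≤ ε * (l₂ * C₀ + (s + 1) * l₁ + ε * l₁) := by
    calc ‖d‖ ≤ ‖T' - T‖ * ‖A x‖ := (T' - T).le_opNorm _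
      _ ≤ ε * l₂ * ‖A x‖ := by gcongr
      _ = ε * (l₂ * ‖x‖) := by rw [norm_adjoint_restrictL]; ring
      _ ≤ _ := by gcongr; exact hxnorm.trans hunorm
  have hTd : T' (A x) = T (A x) + d := by simp [hd]
  -- Passing from `T'` to `T` moves the error `R d` to the right-hand side, so that the population
  -- operator `Q` applies.
  have hBx : B x = u - R d := by
    rw [← hx, hTd, map_add]
    change R (T (A x)) + l₂ • x = _
    abel
  have hbound : ∀ j, j ∉ S → ‖(T' (A x) + W) j‖ ≤ (1 - γ) * (l₂ * C₀ + l₁) + 2 * (ε * l₁)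
      + 2 * (ε * (l₂ * C₀ + (s + 1) * l₁ + ε * l₁)) := by
    intro j hj
    have hTx : T (A x) j = Q (u - R d) ⟨j, Finset.mem_compl.2 hj⟩ := by
      rw [hQ, ContinuousLinearMap.comp_apply, ← hBx, hBinv.inverse_apply_self]
      rfl
    -- Componentwise, `r` contributes only `l₁`; the factor `s + 1` enters solely through `‖d‖`,
    -- where it is multiplied by `ε`.
    have hcoord : ∀ k : S, ‖(u - R d) k‖ ≤ l₂ * C₀ + l₁ + (‖W‖ + ‖d‖) := by
      intro k
      have h0 : (u - R d) k = l₂ • f₀ k + r k - W k - d k := rfl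
      have h1 : ‖l₂ • f₀ k‖ ≤ l₂ * C₀ := by
        rw [norm_smul, Real.norm_of_nonneg hl₂.le]
        gcongr
        exact (PiLp.norm_apply_le f₀ _).trans hC₀
      rw [h0]
      linarith [norm_sub_le (l₂ • f₀ k + r k - W k) (d k), norm_sub_le (l₂ • f₀ k + r k) (W k),
        norm_add_le (l₂ • f₀ k) (r k), hr₁ k, PiLp.norm_apply_le W k, PiLp.norm_apply_le d k]
    have hpos : 0 < l₂ * C₀ + l₁ + (‖W‖ + ‖d‖) := by positivity
    have hQle := norm_apply_le_infInfNorm_mul Q hpos hcoord ⟨j, Finset.mem_compl.2 hj⟩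
    rw [← hTx] at hQle
    have hQle' : ‖T (A x) j‖ ≤ (1 - γ) * (l₂ * C₀ + l₁) + (‖W‖ + ‖d‖) := by
      refine hQle.trans ((mul_le_mul_of_nonneg_right hirr.le hpos.le).trans ?_)
      have : (1 - γ) * (‖W‖ + ‖d‖) ≤ 1 * (‖W‖ + ‖d‖) := by gcongr; linarith
      linarith
    have h0 : (T' (A x) + W) j = T (A x) j + d j + W j := by rw [hTd]; rfl
    rw [h0]
    linarith [norm_add_le (T (A x) j + d j) (W j), norm_add_le (T (A x) j) (d j),
      PiLp.norm_apply_le W j, PiLp.norm_apply_le d j]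
  set θ := (1 - γ) * (l₂ * C₀ + l₁) + 2 * (ε * l₁)
      + 2 * (ε * (l₂ * C₀ + (s + 1) * l₁ + ε * l₁)) with hθ
  obtain ⟨v, hv⟩ : ∃ v, v = f - A (R f) := ⟨_, rfl⟩
  have hvS : ∀ j ∈ S, v j = 0 := fun j hj => by
    rw [hv, PiLp.sub_apply, adjoint_restrictL_apply_of_mem S f hj, sub_self]
  have hvSc : ∀ j, j ∉ S → v j = f j := fun j hj => by
    rw [hv, PiLp.sub_apply, adjoint_restrictL_apply_of_notMem S _ hj, sub_zero]
  have hRv : R v = 0 := by rw [hv, map_sub, hRA, sub_self]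
  obtain ⟨z, hz⟩ : ∃ z, z = R f₀ - R f - x := ⟨_, rfl⟩
  have hdecomp : f₀ - f = A z + A x - v := by
    rw [hz, hv, map_sub, map_sub, hf₀]; abel
  -- The correction `z` due to false positives is the ridge regression of `v` on the coordinates in
  -- `S`.
  have hzeq : R (T' (A z)) + l₂ • z = R (T' v) := by
    have h1 : A z = (f₀ - f) + v - A x := by rw [hdecomp]; abel
    have h2 : R r = R (T' (f₀ - f)) + R W - l₂ • R f := by
      rw [hr, map_sub, map_add, map_smul]
    have h3 : R (T' (A x)) = l₂ • R f₀ + R r - R W - l₂ • x := by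
      rw [eq_sub_iff_add_eq, hx, hu, map_sub, map_add, map_smul]
    rw [h1, map_sub, map_add, map_sub, map_add, h3, h2, hz, smul_sub, smul_sub]
    abel
  have hzin : ⟪T' (A z), A z⟫_ℝ + l₂ * ‖z‖ ^ 2 = ⟪T' v, A z⟫_ℝ := by
    have := congrArg (fun g => ⟪z, g⟫_ℝ) hzeq
    simp only [inner_add_right, real_inner_smul_right, ← hAR, real_inner_self_eq_norm_sq] at this
    rwa [real_inner_comm, real_inner_comm (T' v)] at this
  -- Positivity of the ridge Schur complement: expand `T'` at `A z - v` and use the equation for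
  -- `z`.
  have hschur : ⟪T' (A z), v⟫_ℝ - ⟪T' v, v⟫_ℝ ≤ 0 := by
    have h1 := hT' (A z - v)
    rw [map_sub, inner_sub_left, inner_sub_right, inner_sub_right, hsymm (A z) v] at h1
    rw [hsymm (A z) v]
    linarith [mul_nonneg hl₂.le (sq_nonneg ‖z‖)]
  have hfv : 0 ≤ ⟪f, v⟫_ℝ := by
    have h1 : f = A (R f) + v := by rw [hv]; abel
    have h2 : ⟪f, v⟫_ℝ = ‖v‖ ^ 2 := by
      conv_lhs => rw [h1]
      rw [inner_add_left, hAR, hRv, inner_zero_right, zero_add, real_inner_self_eq_norm_sq]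
    rw [h2]; positivity
  have hrv : ⟪r, v⟫_ℝ ≤ ⟪T' (A x) + W, v⟫_ℝ := by
    rw [hr, hdecomp, map_sub, map_add]
    simp only [inner_sub_left, inner_add_left, real_inner_smul_left]
    have := mul_nonneg hl₂.le hfv
    linarith
  have hlow : l₁ * ∑ j, ‖v j‖ ≤ ⟪r, v⟫_ℝ := by
    rw [PiLp.inner_apply, Finset.mul_sum]
    refine Finset.sum_le_sum fun j _ => ?_
    by_cases hj : j ∈ S
    · simp [hvS j hj]
    · rw [hvSc j hj]; exact hr₂ j
  have hup : ⟪T' (A x) + W, v⟫_ℝ ≤ θ * ∑ j, ‖v j‖ := by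
    rw [PiLp.inner_apply, Finset.mul_sum]
    refine Finset.sum_le_sum fun j _ => ?_
    by_cases hj : j ∈ S
    · simp [hvS j hj]
    · exact (real_inner_le_norm _ _).trans
        (mul_le_mul_of_nonneg_right (hbound j hj) (norm_nonneg _))
  have hsum : ∑ j, ‖v j‖ ≤ 0 := by
    refine nonpos_of_mul_nonpos_right (a := l₁ - θ) ?_ (by linarith)
    linarith
  intro j hjf
  by_contra hj
  refine mem_activeSet.1 hjf ?_
  rw [← hvSc j hj, ← norm_le_zero_iff]
  exact (Finset.single_le_sum (f := fun j => ‖v j‖) (fun _ _ => norm_nonneg _)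
    (Finset.mem_univ j)).trans hsum

end Estimator

/-! ### Chebyshev's inequality in a Hilbert space. -/

section SampleMean

variable {Ω 𝒵 H : Type*} [MeasurableSpace Ω] [MeasurableSpace 𝒵]
  {P : Measure Ω} [IsProbabilityMeasure P] {μ : Measure 𝒵} [IsProbabilityMeasure μ]
  [NormedAddCommGroup H] [InnerProductSpace ℝ H] [CompleteSpace H]
  {n : ℕ} {Z : Fin n → Ω → 𝒵} {ξ : 𝒵 → H}

omit [InnerProductSpace ℝ H] [CompleteSpace H] [IsProbabilityMeasure P]
  [IsProbabilityMeasure μ] in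
theorem memLp_comp_of_hasLaw {X : Ω → 𝒵} (hX : HasLaw X μ P) (hξ : MemLp ξ 2 μ) :
    MemLp (fun ω => ξ (X ω)) 2 P := by
  rw [← hX.map_eq] at hξ
  exact hξ.comp_of_map hX.aemeasurable

omit [CompleteSpace H] [IsProbabilityMeasure P] in
theorem integrable_inner_of_memLp {g h : Ω → H} (hg : MemLp g 2 P) (hh : MemLp h 2 P) :
    Integrable (fun ω => ⟪g ω, h ω⟫_ℝ) P := by
  refine Integrable.mono' (hg.norm.integrable_mul hh.norm)
    (hg.aestronglyMeasurable.inner hh.aestronglyMeasurable) ?_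
  filter_upwards with ω
  simpa using abs_real_inner_le_norm (g ω) (h ω)

-- By independence the expected inner product of two distinct summands is the inner product of their
-- means, so only the diagonal survives.
omit [IsProbabilityMeasure P] in
theorem integral_norm_sum_sq (hlaw : ∀ i, HasLaw (Z i) μ P) (hindep : iIndepFun Z P)
    (hξ : MemLp ξ 2 μ) (h0 : ∫ z, ξ z ∂μ = 0) :
    ∫ ω, ‖∑ i, ξ (Z i ω)‖ ^ 2 ∂P = n * ∫ z, ‖ξ z‖ ^ 2 ∂μ := by
  have hL : ∀ i, MemLp (fun ω => ξ (Z i ω)) 2 P := fun i => memLp_comp_of_hasLaw (hlaw i) hξ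
  have hint : ∀ i k, Integrable (fun ω => ⟪ξ (Z i ω), ξ (Z k ω)⟫_ℝ) P := fun i k =>
    integrable_inner_of_memLp (hL i) (hL k)
  have hmean : ∀ i, ∫ ω, ξ (Z i ω) ∂P = 0 := fun i => by
    rw [← h0]; exact (hlaw i).integral_comp hξ.aestronglyMeasurable
  have hoff : ∀ i k, k ≠ i → ∫ ω, ⟪ξ (Z i ω), ξ (Z k ω)⟫_ℝ ∂P = 0 := fun i k hik => by
    have h1 : ∀ i, Integrable ξ (P.map (Z i)) := fun i => by
      rw [(hlaw i).map_eq]; exact hξ.integrable one_le_two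
    have := (hindep.indepFun hik.symm).integral_bilin_comp_comp (hlaw i).aemeasurable
      (hlaw k).aemeasurable (h1 i) (h1 k) (innerSL ℝ : H →L[ℝ] H →L[ℝ] ℝ)
    rw [hmean, map_zero] at this
    exact this
  have hdiag : ∀ i, ∫ ω, ⟪ξ (Z i ω), ξ (Z i ω)⟫_ℝ ∂P = ∫ z, ‖ξ z‖ ^ 2 ∂μ := fun i => by
    simp only [real_inner_self_eq_norm_sq]
    exact (hlaw i).integral_comp (f := fun z => ‖ξ z‖ ^ 2) (hξ.aestronglyMeasurable.norm.pow 2)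
  have hexp : ∀ ω, ‖∑ i, ξ (Z i ω)‖ ^ 2 = ∑ i, ∑ k, ⟪ξ (Z i ω), ξ (Z k ω)⟫_ℝ := fun ω => by
    rw [← real_inner_self_eq_norm_sq, sum_inner]
    simp only [inner_sum]
  simp only [hexp]
  rw [integral_finsetSum _ fun i _ => integrable_finsetSum _ fun k _ => hint i k]
  have : ∀ i, ∫ ω, ∑ k, ⟪ξ (Z i ω), ξ (Z k ω)⟫_ℝ ∂P = ∫ z, ‖ξ z‖ ^ 2 ∂μ := fun i => by
    rw [integral_finsetSum _ fun k _ => hint i k, Finset.sum_eq_single i, hdiag]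
    · exact fun k _ hk => hoff i k hk
    · simp
  simp [this]

theorem integral_norm_sub_mean_sq_le (hξ : MemLp ξ 2 μ) :
    ∫ z, ‖ξ z - ∫ w, ξ w ∂μ‖ ^ 2 ∂μ ≤ ∫ z, ‖ξ z‖ ^ 2 ∂μ := by
  set m := ∫ w, ξ w ∂μ with hm
  have hi : Integrable ξ μ := hξ.integrable one_le_two
  have h1 : ∀ z, ‖ξ z - m‖ ^ 2 = ‖ξ z‖ ^ 2 - 2 * ⟪m, ξ z⟫_ℝ + ‖m‖ ^ 2 := fun z => by
    rw [norm_sub_sq_real, real_inner_comm]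
  have h2 : ∫ z, ⟪m, ξ z⟫_ℝ ∂μ = ‖m‖ ^ 2 := by
    rw [integral_inner hi, ← hm, real_inner_self_eq_norm_sq]
  have h3 : Integrable (fun z => ‖ξ z‖ ^ 2) μ := hξ.integrable_norm_pow two_ne_zero
  have h4 : Integrable (fun z => ⟪m, ξ z⟫_ℝ) μ := hi.const_inner m
  have h5 : Integrable (fun z => ‖ξ z‖ ^ 2 - 2 * ⟪m, ξ z⟫_ℝ) μ := h3.sub (h4.const_mul 2)
  simp only [h1]
  rw [integral_add h5 (integrable_const _), integral_sub h3 (h4.const_mul 2), integral_const_mul, h2]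
  simp only [integral_const, probReal_univ, one_smul]
  linarith [sq_nonneg ‖m‖]

omit [InnerProductSpace ℝ H] [CompleteSpace H] [IsProbabilityMeasure P]
  [IsProbabilityMeasure μ] in
theorem integrable_norm_sum_sq (hlaw : ∀ i, HasLaw (Z i) μ P) (hξ : MemLp ξ 2 μ) :
    Integrable (fun ω => ‖∑ i, ξ (Z i ω)‖ ^ 2) P := by
  have h : MemLp (fun ω => ∑ i, ξ (Z i ω)) 2 P :=
    memLp_finsetSum _ fun i _ => memLp_comp_of_hasLaw (hlaw i) hξ
  exact h.integrable_norm_pow two_ne_zero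

theorem measureReal_norm_sum_ge_le (hlaw : ∀ i, HasLaw (Z i) μ P) (hindep : iIndepFun Z P)
    (hξ : MemLp ξ 2 μ) (h0 : ∫ z, ξ z ∂μ = 0) (hn : 0 < n) {t : ℝ} (ht : 0 < t) :
    P.real {ω | t ≤ ‖(1 / (n : ℝ)) • ∑ i, ξ (Z i ω)‖} ≤ (∫ z, ‖ξ z‖ ^ 2 ∂μ) / (n * t ^ 2) := by
  have hn' : (0 : ℝ) < n := Nat.cast_pos.2 hn
  have hsub : {ω | t ≤ ‖(1 / (n : ℝ)) • ∑ i, ξ (Z i ω)‖}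
      ⊆ {ω | (n * t) ^ 2 ≤ ‖∑ i, ξ (Z i ω)‖ ^ 2} := by
    intro ω hω
    have hω' : t ≤ (n : ℝ)⁻¹ * ‖∑ i, ξ (Z i ω)‖ := by
      have h1 : ‖(1 / (n : ℝ)) • ∑ i, ξ (Z i ω)‖ = (n : ℝ)⁻¹ * ‖∑ i, ξ (Z i ω)‖ := by
        rw [norm_smul, one_div, norm_inv, Real.norm_natCast]
      rw [← h1]
      exact hω
    have h2 : n * t ≤ ‖∑ i, ξ (Z i ω)‖ := by
      rwa [← div_eq_inv_mul, le_div_iff₀ hn', mul_comm] at hω'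
    exact pow_le_pow_left₀ (by positivity) h2 2
  have hmarkov : (n * t) ^ 2 * P.real {ω | (n * t) ^ 2 ≤ ‖∑ i, ξ (Z i ω)‖ ^ 2}
      ≤ n * ∫ z, ‖ξ z‖ ^ 2 ∂μ :=
    (mul_meas_ge_le_integral_of_nonneg (ae_of_all P fun ω => sq_nonneg ‖∑ i, ξ (Z i ω)‖)
      (integrable_norm_sum_sq hlaw hξ) _).trans_eq (integral_norm_sum_sq hlaw hindep hξ h0)
  have hmono := measureReal_mono (μ := P) hsub
  generalize P.real {ω | (n * t) ^ 2 ≤ ‖∑ i, ξ (Z i ω)‖ ^ 2} = a at hmarkov hmono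
  refine hmono.trans ?_
  rw [le_div_iff₀ (by positivity)]
  refine le_of_mul_le_mul_left (le_trans (le_of_eq ?_) hmarkov) hn'
  ring

/-- Chebyshev's inequality for the sample mean of a Hilbert space valued function. -/
theorem measureReal_norm_sampleMean_ge_le (hlaw : ∀ i, HasLaw (Z i) μ P) (hindep : iIndepFun Z P)
    (hξ : MemLp ξ 2 μ) (hn : 0 < n) {t : ℝ} (ht : 0 < t) :
    P.real {ω | t ≤ ‖(1 / (n : ℝ)) • ∑ i, ξ (Z i ω) - ∫ z, ξ z ∂μ‖}
      ≤ (∫ z, ‖ξ z‖ ^ 2 ∂μ) / (n * t ^ 2) := by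
  have hn' : (0 : ℝ) < n := Nat.cast_pos.2 hn
  have hη0 : ∫ z, (ξ z - ∫ w, ξ w ∂μ) ∂μ = 0 := by
    rw [integral_sub (hξ.integrable one_le_two) (integrable_const _)]
    simp
  have heq : ∀ ω, (1 / (n : ℝ)) • ∑ i, ξ (Z i ω) - ∫ w, ξ w ∂μ
      = (1 / (n : ℝ)) • ∑ i, (ξ (Z i ω) - ∫ w, ξ w ∂μ) := fun ω => by
    rw [Finset.sum_sub_distrib, smul_sub, Finset.sum_const, Finset.card_univ, Fintype.card_fin,
      ← Nat.cast_smul_eq_nsmul ℝ, smul_smul, one_div_mul_cancel hn'.ne', one_smul]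
  simp only [heq]
  refine (measureReal_norm_sum_ge_le hlaw hindep (ξ := fun z => ξ z - ∫ w, ξ w ∂μ)
    (hξ.sub (memLp_const _)) hη0 hn ht).trans ?_
  exact div_le_div_of_nonneg_right (integral_norm_sub_mean_sq_le hξ) (by positivity)

end SampleMean

/-! ### Hilbert–Schmidt control of the empirical covariance. -/

section TensorSquare

open scoped TensorProduct

variable {H : Type*} [NormedAddCommGroup H] [InnerProductSpace ℝ H]

variable (H) in
/-- The Hilbert tensor square of `H`. -/
abbrev HilbertSquare : Type _ := UniformSpace.Completion (H ⊗[ℝ] H)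

/-- The tensor `x ⊗ y` in the Hilbert tensor square. -/
def hilbertTmul (x y : H) : HilbertSquare H := ((x ⊗ₜ[ℝ] y : H ⊗[ℝ] H) : HilbertSquare H)

theorem norm_hilbertTmul (x y : H) : ‖hilbertTmul x y‖ = ‖x‖ * ‖y‖ := by
  rw [hilbertTmul, UniformSpace.Completion.norm_coe, TensorProduct.norm_tmul]

theorem inner_hilbertTmul (x y x' y' : H) :
    ⟪hilbertTmul x y, hilbertTmul x' y'⟫_ℝ = ⟪x, x'⟫_ℝ * ⟪y, y'⟫_ℝ := by
  rw [hilbertTmul, hilbertTmul, UniformSpace.Completion.inner_coe, TensorProduct.inner_tmul]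

theorem continuous_hilbertTmul_self : Continuous fun x : H => hilbertTmul x x :=
  (UniformSpace.Completion.continuous_coe _).comp
    (TensorProduct.continuous_tmul.comp (continuous_id.prodMk continuous_id))

variable {𝒵 : Type*} [MeasurableSpace 𝒵] {μ : Measure 𝒵} [CompleteSpace H]

omit [CompleteSpace H] in
theorem aestronglyMeasurable_rankOne {φ : 𝒵 → H} (hφ : AEStronglyMeasurable φ μ) :
    AEStronglyMeasurable (fun z => InnerProductSpace.rankOne ℝ (φ z) (φ z)) μ :=
  ((InnerProductSpace.rankOne ℝ : H →L[ℝ] H →L⋆[ℝ] H →L[ℝ] H).continuous.clm_apply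
    continuous_id).comp_aestronglyMeasurable hφ

theorem inner_integral_rankOne_apply {φ : 𝒵 → H} (hφ : MemLp φ 2 μ) (u v : H) :
    ⟪u, (∫ z, InnerProductSpace.rankOne ℝ (φ z) (φ z) ∂μ) v⟫_ℝ
      = ∫ z, ⟪u, φ z⟫_ℝ * ⟪v, φ z⟫_ℝ ∂μ := by
  have hint : Integrable (fun z => InnerProductSpace.rankOne ℝ (φ z) (φ z)) μ :=
    (hφ.norm.integrable_mul hφ.norm).mono' (aestronglyMeasurable_rankOne hφ.aestronglyMeasurable)
      (ae_of_all _ fun z => by simp)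
  rw [ContinuousLinearMap.integral_apply hint, ← integral_inner (hint.apply_continuousLinearMap v)]
  refine integral_congr_ae (ae_of_all _ fun z => ?_)
  simp only [InnerProductSpace.rankOne_apply, real_inner_smul_right, real_inner_comm v]
  ring

/-- The distance of the empirical to the population second moment operator in operator norm is at
most the distance of the corresponding tensors. -/
theorem norm_sum_rankOne_sub_integral_le {n : ℕ} {φ : 𝒵 → H} (hφ : MemLp φ 2 μ) (z : Fin n → 𝒵) :
    ‖(1 / (n : ℝ)) • ∑ i, InnerProductSpace.rankOne ℝ (φ (z i)) (φ (z i))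
        - ∫ w, InnerProductSpace.rankOne ℝ (φ w) (φ w) ∂μ‖
      ≤ ‖(1 / (n : ℝ)) • ∑ i, hilbertTmul (φ (z i)) (φ (z i))
        - ∫ w, hilbertTmul (φ w) (φ w) ∂μ‖ := by
  set Δ := (1 / (n : ℝ)) • ∑ i, InnerProductSpace.rankOne ℝ (φ (z i)) (φ (z i))
        - ∫ w, InnerProductSpace.rankOne ℝ (φ w) (φ w) ∂μ with hΔ
  set D := (1 / (n : ℝ)) • ∑ i, hilbertTmul (φ (z i)) (φ (z i))
        - ∫ w, hilbertTmul (φ w) (φ w) ∂μ with hD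
  have hint : Integrable (fun w => hilbertTmul (φ w) (φ w)) μ :=
    (hφ.norm.integrable_mul hφ.norm).mono'
      (continuous_hilbertTmul_self.comp_aestronglyMeasurable hφ.aestronglyMeasurable)
      (ae_of_all _ fun w => by simp [norm_hilbertTmul])
  -- The operator norm is not a Hilbert norm, so second moments are computed in the tensor square.
  -- This duality, tested at `u = Δ v`, carries the bound back to operators.
  have key : ∀ u v, ⟪u, Δ v⟫_ℝ = ⟪hilbertTmul u v, D⟫_ℝ := fun u v => by
    rw [hΔ, hD, sub_apply, inner_sub_right, inner_sub_right, inner_integral_rankOne_apply hφ,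
      ← integral_inner hint]
    simp only [inner_hilbertTmul]
    congr 1
    rw [real_inner_smul_right, inner_sum]
    simp only [inner_hilbertTmul, smul_apply, sum_apply, real_inner_smul_right, inner_sum,
      InnerProductSpace.rankOne_apply, real_inner_comm v]
    congr 1
    exact Finset.sum_congr rfl fun i _ => mul_comm _ _
  refine Δ.opNorm_le_bound (norm_nonneg _) fun v => ?_
  rcases (norm_nonneg (Δ v)).eq_or_lt with h0 | h0
  · rw [← h0]; positivity
  refine le_of_mul_le_mul_left ?_ h0
  calc ‖Δ v‖ * ‖Δ v‖ = ⟪Δ v, Δ v⟫_ℝ := (real_inner_self_eq_norm_mul_norm _).symm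
    _ = ⟪hilbertTmul (Δ v) v, D⟫_ℝ := key _ _
    _ ≤ ‖hilbertTmul (Δ v) v‖ * ‖D‖ := real_inner_le_norm _ _
    _ = ‖Δ v‖ * (‖D‖ * ‖v‖) := by rw [norm_hilbertTmul]; ring

end TensorSquare

/-! ### Moments in the additive model and the bound at a fixed sample size. -/

section Model

variable {ι : Type*} [Fintype ι] {𝒳 : ι → Type*} {M : ι → Type*}
  [∀ j, NormedAddCommGroup (M j)] [∀ j, InnerProductSpace ℝ (M j)] [∀ j, CompleteSpace (M j)]
  [∀ j, RKHS ℝ (M j) (𝒳 j) ℝ] [∀ j, MeasurableSpace (𝒳 j)]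

/-- Strong measurability passes through continuous coordinate embeddings and finite sums, so the `M
j` need not be separable. -/
theorem stronglyMeasurable_feature (hmeas : ∀ j, StronglyMeasurable (kfun (𝒳 := 𝒳) M j)) :
    StronglyMeasurable (feature (𝒳 := 𝒳) M) := by
  classical
  have h : feature (𝒳 := 𝒳) M = fun x => ∑ j, PiLp.single 2 j (kfun M j (x j)) := by
    funext x
    ext k
    simp only [feature, WithLp.ofLp_sum, Finset.sum_apply, PiLp.ofLp_single]
    rw [Finset.sum_eq_single k] <;> simp +contextual [Pi.single_eq_of_ne']
  rw [h]
  refine Finset.stronglyMeasurable_fun_sum _ fun j _ => ?_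
  have hc : Continuous fun v : M j => (PiLp.single 2 j v : PiLp 2 M) :=
    (PiLp.continuous_toLp 2 M).comp (continuous_single j)
  exact hc.comp_stronglyMeasurable ((hmeas j).comp_measurable (measurable_pi_apply j))

variable {𝒴 : Type*} [MetricSpace 𝒴] [MeasurableSpace 𝒴] {L : Measure ((∀ j, 𝒳 j) × 𝒴)}
  [IsProbabilityMeasure L]

omit [∀ j, MeasurableSpace (𝒳 j)] in
theorem norm_feature_le {K : ℝ} (hK : ∀ j x, ‖kfun M j x‖ ≤ K) (x : ∀ j, 𝒳 j) :
    ‖feature M x‖ ≤ √(Fintype.card ι * K ^ 2) :=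
  Real.le_sqrt_of_sq_le (norm_feature_sq_le hK x)

omit [MetricSpace 𝒴] in
theorem memLp_feature (hmeas : ∀ j, StronglyMeasurable (kfun (𝒳 := 𝒳) M j)) {K : ℝ}
    (hK : ∀ j x, ‖kfun (𝒳 := 𝒳) M j x‖ ≤ K) :
    MemLp (fun z : (∀ j, 𝒳 j) × 𝒴 => feature M z.1) 2 L :=
  MemLp.of_bound ((stronglyMeasurable_feature hmeas).comp_measurable
    measurable_fst).aestronglyMeasurable _ (ae_of_all _ fun z => norm_feature_le hK z.1)

omit [MetricSpace 𝒴] [IsProbabilityMeasure L] in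
theorem covOp_fst (hmeas : ∀ j, StronglyMeasurable (kfun (𝒳 := 𝒳) M j)) :
    covOp M L.fst = ∫ z, InnerProductSpace.rankOne ℝ (feature M z.1) (feature M z.1) ∂L :=
  integral_map measurable_fst.aemeasurable
    (aestronglyMeasurable_rankOne (stronglyMeasurable_feature hmeas).aestronglyMeasurable)

theorem memLp_noise_smul_feature (hmeas : ∀ j, StronglyMeasurable (kfun (𝒳 := 𝒳) M j)) {K : ℝ}
    (hK : ∀ j x, ‖kfun (𝒳 := 𝒳) M j x‖ ≤ K) {y y₀ : 𝒴} {f₀ : PiLp 2 M}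
    (hnoise : MemLp (noise (𝒳 := 𝒳) y y₀ f₀) 2 L) :
    MemLp (fun z => noise y y₀ f₀ z • feature M z.1) 2 L := by
  refine hnoise.of_le_mul (c := √(Fintype.card ι * K ^ 2))
    (hnoise.aestronglyMeasurable.smul (memLp_feature hmeas hK).aestronglyMeasurable)
    (ae_of_all _ fun z => ?_)
  rw [norm_smul, mul_comm]
  gcongr
  exact norm_feature_le hK z.1

/-- The feature depends on the covariates only, so it can be pulled out of the conditional
expectation of the error. -/
theorem integral_noise_smul_feature (hmeas : ∀ j, StronglyMeasurable (kfun (𝒳 := 𝒳) M j)) {K : ℝ}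
    (hK : ∀ j x, ‖kfun (𝒳 := 𝒳) M j x‖ ≤ K) {y y₀ : 𝒴} {f₀ : PiLp 2 M}
    (hnoise : MemLp (noise (𝒳 := 𝒳) y y₀ f₀) 2 L)
    (hcentred : L[noise y y₀ f₀ | MeasurableSpace.comap Prod.fst inferInstance] =ᵐ[L] 0) :
    ∫ z, noise y y₀ f₀ z • feature M z.1 ∂L = 0 := by
  have hm : MeasurableSpace.comap (Prod.fst : (∀ j, 𝒳 j) × 𝒴 → ∀ j, 𝒳 j) inferInstance
      ≤ (inferInstance : MeasurableSpace ((∀ j, 𝒳 j) × 𝒴)) := measurable_fst.comap_le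
  have hpull := condExp_smul_of_aestronglyMeasurable_right
    (m := MeasurableSpace.comap Prod.fst inferInstance) (hnoise.integrable one_le_two)
    ((memLp_noise_smul_feature hmeas hK hnoise).integrable one_le_two)
    ((stronglyMeasurable_feature hmeas).comp_measurable
      (comap_measurable Prod.fst)).aestronglyMeasurable
  rw [← integral_condExp hm]
  refine integral_eq_zero_of_ae (hpull.trans ?_)
  filter_upwards [hcentred] with z hz
  simp [hz]

omit [IsProbabilityMeasure L] in
theorem integral_norm_noise_smul_feature_sq_le {K : ℝ}
    (hK : ∀ j x, ‖kfun (𝒳 := 𝒳) M j x‖ ≤ K) {y y₀ : 𝒴} {f₀ : PiLp 2 M}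
    (hnoise : MemLp (noise (𝒳 := 𝒳) y y₀ f₀) 2 L)
    (hvar : ∫ z, noise y y₀ f₀ z ^ 2 ∂L ≤ K) :
    ∫ z, ‖noise y y₀ f₀ z • feature M z.1‖ ^ 2 ∂L ≤ Fintype.card ι * K ^ 3 := by
  have h1 : ∫ z, ‖noise y y₀ f₀ z • feature M z.1‖ ^ 2 ∂L
      ≤ ∫ z, noise y y₀ f₀ z ^ 2 * (Fintype.card ι * K ^ 2) ∂L := by
    refine integral_mono_of_nonneg (ae_of_all _ fun z => by positivity)
      (hnoise.integrable_sq.mul_const _) (ae_of_all _ fun z => ?_)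
    change ‖noise y y₀ f₀ z • feature M z.1‖ ^ 2 ≤ _
    rw [norm_smul, mul_pow, Real.norm_eq_abs, sq_abs]
    exact mul_le_mul_of_nonneg_left (norm_feature_sq_le hK z.1) (sq_nonneg _)
  refine h1.trans ?_
  rw [integral_mul_const]
  refine (mul_le_mul_of_nonneg_right hvar (by positivity)).trans_eq ?_
  ring

omit [MetricSpace 𝒴] in
theorem memLp_hilbertTmul_feature (hmeas : ∀ j, StronglyMeasurable (kfun (𝒳 := 𝒳) M j)) {K : ℝ}
    (hK : ∀ j x, ‖kfun (𝒳 := 𝒳) M j x‖ ≤ K) :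
    MemLp (fun z : (∀ j, 𝒳 j) × 𝒴 => hilbertTmul (feature M z.1) (feature M z.1)) 2 L := by
  refine MemLp.of_bound (continuous_hilbertTmul_self.comp_aestronglyMeasurable
    (memLp_feature hmeas hK).aestronglyMeasurable) (Fintype.card ι * K ^ 2) (ae_of_all _ fun z => ?_)
  rw [norm_hilbertTmul, ← pow_two]
  exact norm_feature_sq_le hK z.1

omit [MetricSpace 𝒴] [∀ j, MeasurableSpace (𝒳 j)] [MeasurableSpace 𝒴] in
theorem integral_norm_hilbertTmul_feature_sq_le [MeasurableSpace ((∀ j, 𝒳 j) × 𝒴)]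
    {L : Measure ((∀ j, 𝒳 j) × 𝒴)} [IsProbabilityMeasure L] {K : ℝ}
    (hK : ∀ j x, ‖kfun (𝒳 := 𝒳) M j x‖ ≤ K) :
    ∫ z, ‖hilbertTmul (feature M z.1) (feature M z.1)‖ ^ 2 ∂L ≤ (Fintype.card ι * K ^ 2) ^ 2 := by
  have h := integral_mono_of_nonneg (μ := L)
    (f := fun z => ‖hilbertTmul (feature M z.1) (feature M z.1)‖ ^ 2)
    (g := fun _ => (Fintype.card ι * K ^ 2) ^ 2) (ae_of_all _ fun z => by positivity)
    (integrable_const _) (ae_of_all _ fun z => by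
      change ‖hilbertTmul (feature M z.1) (feature M z.1)‖ ^ 2 ≤ _
      rw [norm_hilbertTmul, ← pow_two]
      exact pow_le_pow_left₀ (by positivity) (norm_feature_sq_le hK z.1) 2)
  simpa using h

omit [MetricSpace 𝒴] in
theorem inner_covOp_self_nonneg (hmeas : ∀ j, StronglyMeasurable (kfun (𝒳 := 𝒳) M j)) {K : ℝ}
    (hK : ∀ j x, ‖kfun (𝒳 := 𝒳) M j x‖ ≤ K) (g : PiLp 2 M) :
    0 ≤ ⟪covOp M L.fst g, g⟫_ℝ := by
  rw [covOp_fst hmeas, real_inner_comm, inner_integral_rankOne_apply (memLp_feature hmeas hK)]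
  exact integral_nonneg fun z => mul_self_nonneg _

omit [∀ j, MeasurableSpace (𝒳 j)] [MeasurableSpace 𝒴] in
theorem enetScore_eq {n : ℕ} (l₂ : ℝ) (y y₀ : 𝒴) (f₀ f : PiLp 2 M)
    (z : Fin n → (∀ j, 𝒳 j) × 𝒴) :
    enetScore l₂ (fun i => (z i).1) (fun i => response y y₀ (z i).2) f
      = ((1 / (n : ℝ)) • ∑ i, InnerProductSpace.rankOne ℝ (feature M (z i).1) (feature M (z i).1))
          (f₀ - f)
        + (1 / (n : ℝ)) • ∑ i, noise y y₀ f₀ (z i) • feature M (z i).1 - l₂ • f := by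
  simp only [enetScore, smul_apply, sum_apply, InnerProductSpace.rankOne_apply]
  rw [← smul_add, ← Finset.sum_add_distrib]
  refine congrArg (fun g => (1 / (n : ℝ)) • g - l₂ • f) (Finset.sum_congr rfl fun i _ => ?_)
  rw [← add_smul, noise, sum_apply_eq_inner_feature, inner_sub_right,
    real_inner_comm f₀, real_inner_comm f]
  congr 1
  ring

/-- A lower bound for the probability of no false positives at a fixed sample size. -/
theorem one_sub_le_measureReal_activeSet_subset [DecidableEq ι] {Ω : Type*} [MeasurableSpace Ω]
    {P : Measure Ω} [IsProbabilityMeasure P] {n : ℕ} {Z : Fin n → Ω → (∀ j, 𝒳 j) × 𝒴}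
    (hmeas : ∀ j, StronglyMeasurable (kfun (𝒳 := 𝒳) M j))
    (hlaw : ∀ i, HasLaw (Z i) L P) (hindep : iIndepFun Z P) {y y₀ : 𝒴} {f₀ : PiLp 2 M}
    (hnoise : MemLp (noise (𝒳 := 𝒳) y y₀ f₀) 2 L)
    (hcentred : L[noise y y₀ f₀ | MeasurableSpace.comap Prod.fst inferInstance] =ᵐ[L] 0)
    {l₁ l₂ γ C₀ K ε : ℝ} {s : ℕ} (hl₁ : 0 < l₁) (hl₂ : 0 < l₂) (hγ : 0 < γ) (hε : 0 < ε)
    (hn : 0 < n)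
    (hirr : infInfNorm (block (activeSet f₀)ᶜ (activeSet f₀) (covOp M L.fst) ∘L
        (block (activeSet f₀) (activeSet f₀) (covOp M L.fst)
          + l₂ • ContinuousLinearMap.id ℝ _).inverse) < 1 - γ)
    (hK : ∀ j x, ‖kfun (𝒳 := 𝒳) M j x‖ ≤ K) (hC₀ : ‖f₀‖ ≤ C₀)
    (hvar : ∫ z, noise y y₀ f₀ z ^ 2 ∂L ≤ K) (hs : (activeSet f₀).card ≤ s)
    {fhat : Ω → PiLp 2 M}
    (hfhat : ∀ ω, IsMinOn (enetObj l₁ l₂ (fun i => (Z i ω).1)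
      (fun i => response y y₀ (Z i ω).2)) Set.univ (fhat ω))
    (hmargin : (1 - γ) * (l₂ * C₀ + l₁) + 2 * (ε * l₁)
      + 2 * (ε * (l₂ * C₀ + (s + 1) * l₁ + ε * l₁)) < l₁) :
    1 - ((Fintype.card ι * K ^ 2) ^ 2 / (n * (ε * l₂) ^ 2)
        + Fintype.card ι * K ^ 3 / (n * (ε * l₁) ^ 2))
      ≤ P.real {ω | activeSet (fhat ω) ⊆ activeSet f₀} := by
  set W : Ω → PiLp 2 M := fun ω =>
    (1 / (n : ℝ)) • ∑ i, noise y y₀ f₀ (Z i ω) • feature M (Z i ω).1 with hW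
  set D : Ω → HilbertSquare (PiLp 2 M) := fun ω =>
    (1 / (n : ℝ)) • ∑ i, hilbertTmul (feature M (Z i ω).1) (feature M (Z i ω).1)
      - ∫ z, hilbertTmul (feature M z.1) (feature M z.1) ∂L with hD
  have hDprob : P.real {ω | ε * l₂ ≤ ‖D ω‖}
      ≤ (Fintype.card ι * K ^ 2) ^ 2 / (n * (ε * l₂) ^ 2) := by
    refine (measureReal_norm_sampleMean_ge_le hlaw hindep (memLp_hilbertTmul_feature hmeas hK) hn
      (by positivity)).trans ?_
    gcongr
    exact integral_norm_hilbertTmul_feature_sq_le hK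
  have hWprob : P.real {ω | ε * l₁ ≤ ‖W ω‖}
      ≤ Fintype.card ι * K ^ 3 / (n * (ε * l₁) ^ 2) := by
    refine (measureReal_norm_sum_ge_le hlaw hindep (memLp_noise_smul_feature hmeas hK hnoise)
      (integral_noise_smul_feature hmeas hK hnoise hcentred) hn (by positivity)).trans ?_
    gcongr
    exact integral_norm_noise_smul_feature_sq_le hK hnoise hvar
  -- Covering the whole space and using subadditivity avoids complements, so no measurability of
  -- `fhat` is required.
  have hcover : (Set.univ : Set Ω) ⊆ {ω | activeSet (fhat ω) ⊆ activeSet f₀} ∪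
      ({ω | ε * l₂ ≤ ‖D ω‖} ∪ {ω | ε * l₁ ≤ ‖W ω‖}) := by
    intro ω _
    by_cases hDω : ε * l₂ ≤ ‖D ω‖
    · exact Or.inr (Or.inl hDω)
    by_cases hWω : ε * l₁ ≤ ‖W ω‖
    · exact Or.inr (Or.inr hWω)
    refine Or.inl ?_
    push Not at hDω hWω
    refine activeSet_subset_of_stationary hl₁ hl₂ hγ hε.le (inner_covOp_self_nonneg hmeas hK)
      (T' := (1 / (n : ℝ)) • ∑ i, InnerProductSpace.rankOne ℝ (feature M (Z i ω).1)
        (feature M (Z i ω).1)) (fun g => ?_) (fun g h => ?_)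
      (enetScore_eq l₂ y y₀ f₀ (fhat ω) fun i => Z i ω)
      (norm_enetScore_apply_le hl₁.le (hfhat ω)) (mul_norm_le_inner_enetScore hl₁.le (hfhat ω))
      hirr hC₀ hs ?_ hWω.le hmargin
    · simp only [smul_apply, sum_apply, InnerProductSpace.rankOne_apply, real_inner_smul_left,
        sum_inner]
      exact mul_nonneg (by positivity) (Finset.sum_nonneg fun i _ => mul_self_nonneg _)
    · simp only [smul_apply, sum_apply, InnerProductSpace.rankOne_apply, real_inner_smul_left,
        sum_inner]
      congr 1
      exact Finset.sum_congr rfl fun i _ => mul_comm _ _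
    · rw [covOp_fst hmeas]
      exact (norm_sum_rankOne_sub_integral_le (memLp_feature hmeas hK) fun i => Z i ω).trans hDω.le
  have h1 := measureReal_mono (μ := P) hcover
  rw [probReal_univ] at h1
  have h2 := measureReal_union_le (μ := P) {ω | activeSet (fhat ω) ⊆ activeSet f₀}
    ({ω | ε * l₂ ≤ ‖D ω‖} ∪ {ω | ε * l₁ ≤ ‖W ω‖})
  have h3 := measureReal_union_le (μ := P) {ω | ε * l₂ ≤ ‖D ω‖} {ω | ε * l₁ ≤ ‖W ω‖}
  linarith

end Model

/-! ### The choice of `ε` and the limit of the failure bound. -/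

theorem exists_margin {γ C C₀ : ℝ} (hγ : 0 < γ) (hγ1 : γ < 1) (hC₀ : 0 ≤ C₀) (hC : C₀ < C) (s : ℕ) :
    ∃ ε > 0, ∀ l₁ l₂ : ℝ, 0 < l₁ → 0 < l₂ → l₁ / l₂ > C * ((1 - γ) / γ) →
      (1 - γ) * (l₂ * C₀ + l₁) + 2 * (ε * l₁)
        + 2 * (ε * (l₂ * C₀ + (s + 1) * l₁ + ε * l₁)) < l₁ := by
  have hγ' : 0 < 1 - γ := by linarith
  have hCpos : 0 < C := hC₀.trans_lt hC
  set κ := γ / (1 - γ) with hκ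
  have hκ0 : 0 < κ := by positivity
  have hq0 : 0 ≤ C₀ / C := by positivity
  have hq1 : C₀ / C < 1 := (div_lt_one hCpos).2 hC
  have hden : 0 < 2 * κ + 2 * s + 7 := by positivity
  set δ := γ * (1 - C₀ / C) with hδ
  have hδ0 : 0 < δ := mul_pos hγ (by linarith)
  have hδ1 : δ ≤ 1 := mul_le_one₀ hγ1.le (by linarith) (by linarith)
  -- The available slack is `δ * l₁`. The `ε`-terms cost at most `ε * l₁ * (2 * κ + 2 * s + 6)`; the
  -- `7` makes the inequality strict.
  refine ⟨δ / (2 * κ + 2 * s + 7), by positivity, fun l₁ l₂ hl₁ hl₂ hratio => ?_⟩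
  set ε := δ / (2 * κ + 2 * s + 7) with hε
  have hε0 : 0 < ε := by positivity
  have hεδ : ε * (2 * κ + 2 * s + 7) = δ := div_mul_cancel₀ _ hden.ne'
  have hε1 : ε ≤ 1 := by
    rw [hε, div_le_one hden]
    have : (0 : ℝ) ≤ s := Nat.cast_nonneg s
    linarith
  have h1 : l₂ * C ≤ κ * l₁ := by
    have h2 : C * ((1 - γ) / γ) * l₂ < l₁ := (lt_div_iff₀ hl₂).1 hratio
    have h3 : κ * (C * ((1 - γ) / γ) * l₂) = l₂ * C := by
      rw [hκ]; field_simp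
    rw [← h3]
    gcongr
  have h2 : (1 - γ) * (l₂ * C₀) ≤ γ * (C₀ / C) * l₁ := by
    calc (1 - γ) * (l₂ * C₀) = (1 - γ) * (C₀ / C) * (l₂ * C) := by field_simp
      _ ≤ (1 - γ) * (C₀ / C) * (κ * l₁) := by gcongr
      _ = _ := by rw [hκ]; field_simp
  have h3 : l₂ * C₀ ≤ κ * l₁ := le_trans (by gcongr) h1
  have h4 : ε * (l₂ * C₀ + (s + 1) * l₁ + ε * l₁) ≤ ε * (κ * l₁ + (s + 1) * l₁ + 1 * l₁) := by
    gcongr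
  have h5 : 0 < ε * l₁ := by positivity
  have h6 : ε * l₁ * (2 * κ + 2 * s + 7) = (γ - γ * (C₀ / C)) * l₁ := by
    rw [mul_right_comm, hεδ, hδ]; ring
  linarith

/-- Both terms are at most a constant times the square of `p / (√n l₂)`, which is `l₂` divided by
the diverging scale. For the second term this uses `c * l₂ < l₁` and `p ≤ p ^ 2`. -/
theorem tendsto_falsePositiveBound {p : ℕ → ℕ} {l₁ l₂ : ℕ → ℝ} {K ε c : ℝ} (hε : 0 < ε)
    (hc : 0 < c) (hl₂ : ∀ n, 0 < l₂ n) (hratio : ∀ n, c * l₂ n < l₁ n)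
    (hscale : Tendsto (fun n : ℕ => √(n : ℝ) * l₂ n ^ 2 / (p n : ℝ)) atTop atTop)
    (hl₁ : Tendsto l₁ atTop (𝓝 0)) :
    Tendsto (fun n : ℕ => ((p n : ℝ) * K ^ 2) ^ 2 / (n * (ε * l₂ n) ^ 2)
      + p n * K ^ 3 / (n * (ε * l₁ n) ^ 2)) atTop (𝓝 0) := by
  have hl₂0 : Tendsto l₂ atTop (𝓝 0) := by
    refine squeeze_zero (fun n => (hl₂ n).le) (fun n => ?_) (by simpa using hl₁.div_const c)
    rw [le_div_iff₀ hc, mul_comm]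
    exact (hratio n).le
  set ρ : ℕ → ℝ := fun n => l₂ n / (√(n : ℝ) * l₂ n ^ 2 / (p n : ℝ)) with hρ
  have hρ0 : Tendsto ρ atTop (𝓝 0) := hl₂0.div_atTop hscale
  have hρsq : ∀ n, ρ n ^ 2 = (p n : ℝ) ^ 2 / (n * l₂ n ^ 2) := fun n => by
    have h2 := (hl₂ n).ne'
    have h1 : ρ n = p n / (√(n : ℝ) * l₂ n) := by
      simp only [hρ]
      rw [div_div_eq_mul_div, pow_two, ← mul_assoc, mul_comm (l₂ n) (p n : ℝ),
        mul_div_mul_right _ _ h2]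
    rw [h1, div_pow, mul_pow, Real.sq_sqrt (Nat.cast_nonneg n)]
  have hlim : Tendsto (fun n => K ^ 4 / ε ^ 2 * ρ n ^ 2 + |K| ^ 3 / (ε ^ 2 * c ^ 2) * ρ n ^ 2)
      atTop (𝓝 0) := by
    simpa using ((hρ0.pow 2).const_mul (K ^ 4 / ε ^ 2)).add
      ((hρ0.pow 2).const_mul (|K| ^ 3 / (ε ^ 2 * c ^ 2)))
  refine squeeze_zero_norm' ?_ hlim
  filter_upwards [eventually_gt_atTop 0] with n hn
  have hn' : (0 : ℝ) < n := Nat.cast_pos.2 hn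
  have h2 := hl₂ n
  have h1 : 0 < l₁ n := (mul_pos hc h2).trans (hratio n)
  refine (norm_add_le _ _).trans (add_le_add (le_of_eq ?_) ?_)
  · rw [Real.norm_of_nonneg (by positivity), hρsq]
    field_simp
  · rw [norm_div, norm_mul, norm_pow, Real.norm_natCast, Real.norm_eq_abs,
      Real.norm_of_nonneg (by positivity : (0 : ℝ) ≤ n * (ε * l₁ n) ^ 2), hρsq]
    have hp : (p n : ℝ) ≤ (p n : ℝ) ^ 2 := by
      exact_mod_cast Nat.le_self_pow two_ne_zero (p n)
    calc (p n : ℝ) * |K| ^ 3 / (n * (ε * l₁ n) ^ 2)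
        ≤ (p n : ℝ) ^ 2 * |K| ^ 3 / (n * (ε * (c * l₂ n)) ^ 2) := by
          gcongr
          exact (hratio n).le
      _ = _ := by field_simp

end AdditiveRKHS

end

/-! ### Passage to the limit. -/

open AdditiveRKHS in
theorem theorem3
    -- number of covariates at sample size `n`
    (p : ℕ → ℕ)
    -- covariate spaces, response space, and the RKHS of each covariate
    {𝒳 : (n : ℕ) → Fin (p n) → Type*}
    [∀ n j, MetricSpace (𝒳 n j)] [∀ n j, MeasurableSpace (𝒳 n j)] [∀ n j, BorelSpace (𝒳 n j)]
    {𝒴 : Type*} [MetricSpace 𝒴] [MeasurableSpace 𝒴] [BorelSpace 𝒴] (y y₀ : 𝒴)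
    (M : (n : ℕ) → Fin (p n) → Type*)
    [∀ n j, NormedAddCommGroup (M n j)] [∀ n j, InnerProductSpace ℝ (M n j)]
    [∀ n j, CompleteSpace (M n j)] [∀ n j, RKHS ℝ (M n j) (𝒳 n j) ℝ]
    (hmeas : ∀ n j, StronglyMeasurable (kfun (M n) j))
    -- joint law of `(X, Y)`, and an i.i.d. sample of size `n` from it
    (L : (n : ℕ) → Measure ((∀ j, 𝒳 n j) × 𝒴)) [∀ n, IsProbabilityMeasure (L n)]
    {Ω : ℕ → Type*} [∀ n, MeasurableSpace (Ω n)] (P : (n : ℕ) → Measure (Ω n))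
    [∀ n, IsProbabilityMeasure (P n)]
    (Z : (n : ℕ) → Fin n → Ω n → (∀ j, 𝒳 n j) × 𝒴)
    (hlaw : ∀ n i, HasLaw (Z n i) (L n) (P n))
    (hindep : ∀ n, iIndepFun (Z n) (P n))
    -- the additive model with signal `f₀` and conditionally centred, square integrable error
    (f₀ : (n : ℕ) → PiLp 2 (M n))
    (hnoise : ∀ n, MemLp (noise y y₀ (f₀ n)) 2 (L n))
    (hcentred : ∀ n,
      (L n)[noise y y₀ (f₀ n) | MeasurableSpace.comap Prod.fst inferInstance] =ᵐ[L n] 0)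
    -- tuning parameters and constants
    (l₁ l₂ : ℕ → ℝ) (hl₁ : ∀ n, 0 < l₁ n) (hl₂ : ∀ n, 0 < l₂ n)
    (γ C K : ℝ) (hγ : 0 < γ) (hC : 1 < C)
    -- irrepresentable condition
    (hirr : ∀ n, infInfNorm
      (block (activeSet (f₀ n))ᶜ (activeSet (f₀ n)) (covOp (M n) (L n).fst) ∘L
        (block (activeSet (f₀ n)) (activeSet (f₀ n)) (covOp (M n) (L n).fst)
          + l₂ n • ContinuousLinearMap.id ℝ _).inverse) < 1 - γ)
    -- scaling of the tuning parameters
    (hratio : ∀ n, l₁ n / l₂ n > C * ((1 - γ) / γ))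
    (hscale : Tendsto (fun n : ℕ => √(n : ℝ) * l₂ n ^ 2 / (p n : ℝ)) atTop atTop)
    (hl₁0 : Tendsto l₁ atTop (𝓝 0))
    -- boundedness
    (hkernel : ∀ n j x, ‖kfun (M n) j x‖ < K)
    (hsignal : ∃ C₀ < C, ∀ n, ‖f₀ n‖ ≤ C₀)
    (hvar : ∀ n, ∫ z, noise y y₀ (f₀ n) z ^ 2 ∂(L n) < K)
    (hdiag : ∀ n j, ∫ z, ker (M n) j (z.1 j) (z.1 j) ∂(L n) < K)
    -- dimensionality
    (hp : (fun n => (p n : ℝ)) =o[atTop] fun n => √(n : ℝ))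
    (s : ℕ) (hs : ∀ n, (activeSet (f₀ n)).card ≤ s)
    -- the elastic-net estimator
    (fhat : (n : ℕ) → Ω n → PiLp 2 (M n))
    (hfhat : ∀ n ω, IsMinOn
      (enetObj (l₁ n) (l₂ n) (fun i => (Z n i ω).1) (fun i => response y y₀ (Z n i ω).2))
      Set.univ (fhat n ω)) :
    Tendsto (fun n => P n {ω | activeSet (fhat n ω) ⊆ activeSet (f₀ n)}) atTop (𝓝 1) := by
  obtain ⟨C₀, hC₀C, hC₀⟩ := hsignal
  have hC₀0 : 0 ≤ C₀ := (norm_nonneg _).trans (hC₀ 0)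
  have hK0 : 0 < K := (integral_nonneg fun z => sq_nonneg _).trans_lt (hvar 0)
  -- The irrepresentable condition itself forces `γ < 1`, since the norm is nonnegative.
  have hγ1 : γ < 1 := by linarith [(infInfNorm_nonneg _).trans_lt (hirr 0)]
  obtain ⟨ε, hε, hmargin⟩ := exists_margin hγ hγ1 hC₀0 hC₀C s
  have hc : 0 < C * ((1 - γ) / γ) := by
    have : 0 < 1 - γ := by linarith
    positivity
  have hbad := tendsto_falsePositiveBound (K := K) hε hc hl₂
    (fun n => by rw [← lt_div_iff₀ (hl₂ n)]; exact hratio n) hscale hl₁0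
  have hreal : Tendsto (fun n => (P n).real {ω | activeSet (fhat n ω) ⊆ activeSet (f₀ n)})
      atTop (𝓝 1) := by
    have hlow : Tendsto (fun n : ℕ => 1 - (((p n : ℝ) * K ^ 2) ^ 2 / (n * (ε * l₂ n) ^ 2)
        + p n * K ^ 3 / (n * (ε * l₁ n) ^ 2))) atTop (𝓝 1) := by
      simpa using hbad.const_sub 1
    refine tendsto_of_tendsto_of_tendsto_of_le_of_le' hlow tendsto_const_nhds ?_
      (Eventually.of_forall fun n => measureReal_le_one)
    filter_upwards [eventually_gt_atTop 0] with n hn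
    have := one_sub_le_measureReal_activeSet_subset (hmeas n) (hlaw n) (hindep n) (hnoise n)
      (hcentred n) (hl₁ n) (hl₂ n) hγ hε hn (hirr n) (fun j x => (hkernel n j x).le) (hC₀ n)
      (hvar n).le (hs n) (hfhat n) (hmargin (l₁ n) (l₂ n) (hl₁ n) (hl₂ n) (hratio n))
    rwa [Fintype.card_fin] at this
  have hofReal := ENNReal.tendsto_ofReal hreal
  rw [ENNReal.ofReal_one] at hofReal
  exact hofReal.congr fun n => ofReal_measureReal
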